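/- Call a nonnegative random variable $Y$ *light-tailed* if $\mathbf E e^{cY}<\infty$ for some $c>0$. Let $d$ be a dimension, $\lambda\ge 0$, and let $(\xi,\sigma)$ be a pair of nonnegative random variables (diameter and height of the typical grain) such that $\xi^d$ and $\sigma$ are light-tailed. *Boolean Model 5.* At each lattice point $z\in\mathbb Z^d$ and each time $n\in\mathbb Z$ there arrives a Poisson($\lambda$) number $M_n^z$ of cubic grains with i.i.d. marks $(\xi_{n,i}^z,\sigma_{n,i}^z)$, $1\le i\le M_n^z$, distributed as $(\xi,\sigma)$, everything being independent over $z$ and $n$. If $M_n^z\ge 1$, there is at time $n$ a ball at $z$, namely the $L_\infty$ ball of $\mathbb Z^d$ with center $z$ and radius $R_n^z=\max_{i\le M_n^z}(\lfloor \xi_{n,i}^z\rfloor+1)$. The clump $\widehat C_n^z$ is the union of all balls of time $n$ that are connected, through a finite chain of successively intersecting balls of time $n$, with a ball of time $n$ that contains $z$; it is empty if there is no such ball. Let $\widehat\sigma_n^z=\sum_{x\in\widehat C_n^z}\sum_{i\le M_n^x}\sigma_{n,i}^x$. Let $\lambda_c\in[0,\infty]$ be the critical intensity below which the clump is a.s.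 finite and light-tailed, that is, the supremum of the $\ell$ such that for every $\lambda'<\ell$ the cardinality of $\widehat C_0^0$ at intensity $\lambda'$ is a.s. finite and light-tailed. A path of length $n$ from $x_0$ is a sequence $(x_0,\dots,x_n)$ in $\mathbb Z^d$ with $x_{i+1}\in\widehat C_{-i}^{x_i}\cup\{x_i\}$ for $0\le i<n$; its height is $\sum_{i=0}^{n-1}\widehat\sigma_{-i}^{x_i}$. Let $\widehat{\mathbb H}^{x_0}(n)$ be the maximal height of the paths of length $n$ from $x_0$. *Branching process with heights.* Start from one individual in generation $0$; give every individual $u$ a number of children $v_u\in\{0,1,2,\dots\}$ and a node height $s_u\ge 0$, where the pairs $(v_u,s_u)$ are i.i.d. over individuals, $v_u$ and $s_u$ are independent, and both are light-tailed. The height of an individual of generation $n$ is the sum of the node heights of its $n$ ancestors in generations $0,\dots,n-1$; let $h(n)$ be the maximal height of the individuals of generation $n$ ($0$ if there are none). **Theorem 2.** Assume that $\lambda<\lambda_c$. For every branching process with heights as above there is a finite positive constant $c$, which depends only on $d$, $\lambda$ and the laws of $(\xi,\sigma)$, $v$ and $s$, such that $$\limsup_{n\to\infty}\frac{h(n)}{n}\le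 c\quad\text{a.s.},\qquad\text{and, for each }x_0\in\mathbb Z^d,\qquad \limsup_{n\to\infty}\frac{\widehat{\mathbb H}^{x_0}(n)}{n}\le c\quad\text{a.s.}$$ -/

import Mathlib

open MeasureTheory ProbabilityTheory Filter
open scoped NNReal ENNReal

namespace PoissonHail

/-- A real random variable `Y` is light-tailed under `P` if `E exp (c Y) < ∞` for some `c > 0`. -/
def LightTailed {Ω : Type*} [MeasurableSpace Ω] (P : Measure Ω) (Y : Ω → ℝ) : Prop :=
  ∃ c : ℝ, 0 < c ∧ ∫⁻ ω, ENNReal.ofReal (Real.exp (c * Y ω)) ∂P < ⊤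

/-! ### One time layer of the discrete Boolean model -/

/-- What arrives at one lattice site at one time: the number `M` of RACS, and the list of their
marks `(ξ, σ)` (diameter, height), of which the first `M` are used. -/
abbrev Site : Type := ℕ × (ℕ → ℝ≥0 × ℝ≥0)

/-- The law of the arrivals at a site: a Poisson number of parameter `lam`, and independently of it
i.i.d. marks of law `ν`. -/
noncomputable def siteLaw (lam : ℝ≥0) (ν : Measure (ℝ≥0 × ℝ≥0)) [IsProbabilityMeasure ν] :
    Measure Site :=
  (poissonMeasure lam).prod (Measure.infinitePi fun _ : ℕ => ν)

/-- The half-side `⌊ξ⌋ + 1` of the lattice cube of side `2 ⌊ξ⌋ + 2` which replaces a RACS of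
diameter `ξ`. -/
noncomputable def halfSide (ξ : ℝ≥0) : ℕ := ⌊ξ⌋₊ + 1

/-- The maximal half-side of the cubes which arrive at a site (zero if there is none). -/
noncomputable def maxRadius (a : Site) : ℕ :=
  (Finset.range a.1).sup fun i => halfSide (a.2 i).1

/-- The total height of the RACS which arrive at a site. -/
noncomputable def sumHeight (a : Site) : ℝ≥0 := ∑ i ∈ Finset.range a.1, (a.2 i).2

variable {d : ℕ}

/-- The lattice ball (for the sup norm) at `z` in the layer `η`; there is none, and the set is
empty, if nothing arrives at `z`. -/
def ball (η : (Fin d → ℤ) → Site) (z : Fin d → ℤ) : Set (Fin d → ℤ) :=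
  {y | 1 ≤ (η z).1 ∧ ∀ i, |y i - z i| ≤ (maxRadius (η z) : ℤ)}

/-- The clump of `z` in the layer `η`: the union of the balls which are linked, by a finite chain
of balls in which each one meets the next, to a ball that contains `z`. It is empty if no ball
contains `z`. -/
def clump (η : (Fin d → ℤ) → Site) (z : Fin d → ℤ) : Set (Fin d → ℤ) :=
  {y | ∃ a b, z ∈ ball η a ∧ y ∈ ball η b ∧
    Relation.ReflTransGen (fun u v => (ball η u ∩ ball η v).Nonempty) a b}

/-- The total height of all RACS in the clump of `z`. -/
noncomputable def clumpHeight (η : (Fin d → ℤ) → Site) (z : Fin d → ℤ) : ℝ≥0∞ :=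
  ∑' x : clump η z, (sumHeight (η x) : ℝ≥0∞)

/-- The law of a time layer: the sites are i.i.d. -/
noncomputable def layerLaw (d : ℕ) (lam : ℝ≥0) (ν : Measure (ℝ≥0 × ℝ≥0))
    [IsProbabilityMeasure ν] : Measure ((Fin d → ℤ) → Site) :=
  haveI : IsProbabilityMeasure (siteLaw lam ν) := by unfold siteLaw; infer_instance
  Measure.infinitePi fun _ : Fin d → ℤ => siteLaw lam ν

/-- At intensity `lam`, the clump of the origin is a.s. finite and its cardinality is
light-tailed. -/
def ClumpLightTailed (d : ℕ) (lam : ℝ≥0) (ν : Measure (ℝ≥0 × ℝ≥0))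
    [IsProbabilityMeasure ν] : Prop :=
  (∀ᵐ η ∂layerLaw d lam ν, (clump η 0).Finite) ∧
    LightTailed (layerLaw d lam ν) fun η => ((clump η 0).ncard : ℝ)

/-- The critical intensity: the value below which the clump is a.s. finite and light-tailed. -/
noncomputable def criticalIntensity (d : ℕ) (ν : Measure (ℝ≥0 × ℝ≥0))
    [IsProbabilityMeasure ν] : ℝ≥0∞ :=
  sSup {l : ℝ≥0∞ | ∀ lam : ℝ≥0, (lam : ℝ≥0∞) < l → ClumpLightTailed d lam ν}

/-! ### Boolean Model 5, backward construction -/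

/-- `X` is a realization on `(Ω, P)` of the arrivals of Boolean Model 5: the arrivals `X (n, z)` at
time `n` and site `z` are i.i.d. in `n` and `z`, with law `siteLaw lam ν`. -/
structure IsBooleanModel {Ω : Type*} [MeasurableSpace Ω] (P : Measure Ω) (lam : ℝ≥0)
    (ν : Measure (ℝ≥0 × ℝ≥0)) [IsProbabilityMeasure ν]
    (X : ℤ × (Fin d → ℤ) → Ω → Site) : Prop where
  indep : iIndepFun X P
  law : ∀ k, HasLaw (X k) (siteLaw lam ν) P

/-- The layer of time `n` of a space-time configuration. -/
def layer (c : ℤ × (Fin d → ℤ) → Site) (n : ℤ) : (Fin d → ℤ) → Site := fun z => c (n, z)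

/-- `x₀, …, xₙ` is a path of the backward construction: `xᵢ₊₁` is `xᵢ` or is in the clump of `xᵢ`
at time `-i`. -/
def IsPath (c : ℤ × (Fin d → ℤ) → Site) {n : ℕ} (x : Fin (n + 1) → Fin d → ℤ) : Prop :=
  ∀ i : Fin n, x i.succ ∈ clump (layer c (-(i : ℤ))) (x i.castSucc) ∪ {x i.castSucc}

/-- The height of a path: the sum of the heights of the clumps of `x₀, …, xₙ₋₁` at the times
`0, …, -(n - 1)`. -/
noncomputable def pathHeight (c : ℤ × (Fin d → ℤ) → Site) {n : ℕ}
    (x : Fin (n + 1) → Fin d → ℤ) : ℝ≥0∞ :=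
  ∑ i : Fin n, clumpHeight (layer c (-(i : ℤ))) (x i.castSucc)

/-- The maximal height of the paths of length `n` that start from `x₀`. -/
noncomputable def maxPathHeight (c : ℤ × (Fin d → ℤ) → Site) (x₀ : Fin d → ℤ) (n : ℕ) : ℝ≥0∞ :=
  ⨆ x : {x : Fin (n + 1) → Fin d → ℤ // x 0 = x₀ ∧ IsPath c x}, pathHeight c x.1

/-! ### The branching process with heights -/

/-- `(v, s)` is a realization on `(Ω, P)` of the data of a branching process with heights, started
from one individual. Potential individuals are finite words, the root being the empty word and
`j :: u` being the `j`-th child of `u`; the pairs (progeny size, height) are i.i.d., and the two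
members of a pair are independent, with laws `ρ` and `τ`. -/
structure IsBranching {Ω : Type*} [MeasurableSpace Ω] (P : Measure Ω) (ρ : Measure ℕ)
    (τ : Measure ℝ≥0) (v : List ℕ → Ω → ℕ) (s : List ℕ → Ω → ℝ≥0) : Prop where
  indep : iIndepFun (fun u ω => (v u ω, s u ω)) P
  law : ∀ u, HasLaw (fun ω => (v u ω, s u ω)) (ρ.prod τ) P

/-- The individuals of generation `n` of the tree in which `u` has `v u` children. -/
def generation (v : List ℕ → ℕ) : ℕ → Set (List ℕ)
  | 0 => {[]}
  | n + 1 => {w | ∃ u ∈ generation v n, ∃ j < v u, w = j :: u}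

/-- The height of an individual: the sum of the node heights of its strict ancestors. -/
def nodeHeight (s : List ℕ → ℝ≥0) : List ℕ → ℝ≥0
  | [] => 0
  | _ :: u => nodeHeight s u + s u

/-- The maximal height of the individuals of generation `n` (zero if there is none). -/
noncomputable def maxHeight (v : List ℕ → ℕ) (s : List ℕ → ℝ≥0) (n : ℕ) : ℝ≥0∞ :=
  ⨆ u ∈ generation v n, (nodeHeight s u : ℝ≥0∞)

end PoissonHail

/-! Both bounds are first-moment estimates. Let `W n` be the sum of exp(θ · height) over all
individuals of generation `n`, or over all paths of length `n`. Each generation, and each time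
layer, brings randomness independent of the past, so by linearity of expectation E W n is at most m
^ n, whatever the dependence between paths that share a layer. Then the sum of W n / (2m) ^ n
converges a.s. (with m enlarged to be at least 1), so exp(θ · maximal height) ≤ (2m) ^ n eventually,
and the limsup is at most log(2m) / θ (`ae_limsup_div_le`).

It remains to find θ > 0 with m finite. For the branching process m = E v · E exp(θ s). For paths, m
is at most E[(N + 1) exp(θ S)], where N and S are the cardinality and the height of the clump of the
origin. Here N is light-tailed by subcriticality, but S is a sum over a random set that depends on
the summands. Connectedness decouples them: a clump is the range of a nearest-neighbour walk of
length at most 2N. The range of a fixed walk is a deterministic set of i.i.d. sites, and walks of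
length n number only exponentially many; discounting them by b ^ n with b small gives E[exp(θ₀ S) b
^ (2N)] < ∞ (`lintegral_walkWeight_le`, `expMul_clumpHeight_mul_le_walkWeight`). Interpolating with
E exp(κ N) < ∞ removes the discount at the price of a smaller θ (`exists_exp_bound`). -/

namespace PoissonHail

/-! ### The exponential on the extended nonnegative reals -/

/-- `exp (θ x)` for an extended nonnegative real `x`. -/
noncomputable def expMul (θ : ℝ≥0) (x : ℝ≥0∞) : ℝ≥0∞ := EReal.exp ((θ * x : ℝ≥0∞) : EReal)

lemma expMul_coe (θ x : ℝ≥0) : expMul θ x = ENNReal.ofReal (Real.exp (θ * x)) := by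
  unfold expMul
  rw [← ENNReal.coe_mul]
  exact EReal.exp_coe _

lemma expMul_zero (θ : ℝ≥0) : expMul θ 0 = 1 := by simp [expMul]

lemma expMul_add (θ : ℝ≥0) (x y : ℝ≥0∞) : expMul θ (x + y) = expMul θ x * expMul θ y := by
  unfold expMul
  rw [mul_add, EReal.coe_ennreal_add, EReal.exp_add]

lemma expMul_sum {ι : Type*} (θ : ℝ≥0) (s : Finset ι) (f : ι → ℝ≥0∞) :
    expMul θ (∑ i ∈ s, f i) = ∏ i ∈ s, expMul θ (f i) := by
  classical
  induction s using Finset.induction_on with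
  | empty => simp [expMul_zero]
  | insert a s ha ih => rw [Finset.sum_insert ha, Finset.prod_insert ha, expMul_add, ih]

lemma expMul_mono (θ : ℝ≥0) : Monotone (expMul θ) := fun _ _ h =>
  EReal.exp_monotone (EReal.coe_ennreal_le_coe_ennreal_iff.2 (mul_le_mul_right h _))

lemma one_le_expMul (θ : ℝ≥0) (x : ℝ≥0∞) : 1 ≤ expMul θ x := by
  rw [← expMul_zero θ]
  exact expMul_mono θ zero_le

@[fun_prop]
lemma measurable_expMul (θ : ℝ≥0) : Measurable (expMul θ) := by
  unfold expMul
  fun_prop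

/-- For θ > 0 the condition `expMul θ x ≤ z` is an upper bound x ≤ log z / θ, which passes to
arbitrary suprema. Taking 1 ≤ z keeps this bound nonnegative and covers empty suprema. -/
lemma expMul_iSup_le {ι : Sort*} {θ : ℝ≥0} (hθ : 0 < θ) {f : ι → ℝ≥0∞} {z : ℝ≥0∞} (hz : 1 ≤ z)
    (h : ∀ i, expMul θ (f i) ≤ z) : expMul θ (⨆ i, f i) ≤ z := by
  have key : ∀ x, expMul θ x ≤ z ↔ x ≤ (ENNReal.log z).toENNReal / θ := by
    intro x
    have h0 : 0 ≤ ENNReal.log z := ENNReal.zero_le_log_iff.2 hz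
    rw [ENNReal.le_div_iff_mul_le (by simp [hθ.ne']) (by simp), mul_comm, expMul,
      ← ENNReal.log_le_log_iff, EReal.log_exp,
      ← EReal.coe_ennreal_le_coe_ennreal_iff (y := z.log.toENNReal), EReal.coe_toENNReal h0]
  simp only [key] at h ⊢
  exact iSup_le h

/-- Light-tailedness of a nonnegative variable, in terms of `expMul`. -/
lemma LightTailed.exists_expMul {Ω : Type*} [MeasurableSpace Ω] {P : Measure Ω} {Y : Ω → ℝ≥0}
    (h : LightTailed P fun ω => (Y ω : ℝ)) :
    ∃ θ : ℝ≥0, 0 < θ ∧ ∫⁻ ω, expMul θ (Y ω) ∂P < ⊤ := by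
  obtain ⟨c, hc, h⟩ := h
  refine ⟨⟨c, hc.le⟩, hc, ?_⟩
  exact (lintegral_mono fun ω => (expMul_coe _ _).le).trans_lt h

/-! ### Almost sure linear growth from exponential moments -/

/-- The series of Z n / (2m) ^ n has expectation at most A times the sum of 2⁻ⁿ, so it converges
a.s. and Z n < (2m) ^ n eventually. Only the majorant `Z` needs to be measurable. -/
theorem ae_limsup_div_le {Ω : Type*} [MeasurableSpace Ω] {P : Measure Ω} {H Z : ℕ → Ω → ℝ≥0∞}
    (hZ : ∀ n, AEMeasurable (Z n) P) {θ m A : ℝ≥0} (hθ : 0 < θ) (hm : 1 ≤ m)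
    (hle : ∀ n ω, expMul θ (H n ω) ≤ Z n ω) (hint : ∀ n, ∫⁻ ω, Z n ω ∂P ≤ A * (m : ℝ≥0∞) ^ n) :
    ∀ᵐ ω ∂P, limsup (fun n : ℕ => H n ω / (n : ℝ≥0∞)) atTop
      ≤ ((Real.log (2 * m) / θ).toNNReal : ℝ≥0∞) := by
  have hm0 : (0 : ℝ) < m := lt_of_lt_of_le one_pos (by exact_mod_cast hm)
  have h2m : (0 : ℝ) < 2 * m := by positivity
  have hθ' : (0 : ℝ) < θ := hθ
  have hlog : 0 ≤ Real.log (2 * m) := Real.log_nonneg (by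
    have : (1 : ℝ) ≤ m := by exact_mod_cast hm
    linarith)
  have hq0 : ((2 * m : ℝ≥0) : ℝ≥0∞) ≠ 0 := by
    simp only [ne_eq, ENNReal.coe_eq_zero]
    positivity
  have hfin : ∫⁻ ω, ∑' n, Z n ω * ((2 * m : ℝ≥0) : ℝ≥0∞)⁻¹ ^ n ∂P ≠ ⊤ := by
    rw [lintegral_tsum (fun n => (hZ n).mul_const _)]
    have hb : ∀ n, ∫⁻ ω, Z n ω * ((2 * m : ℝ≥0) : ℝ≥0∞)⁻¹ ^ n ∂P
        ≤ A * (2 : ℝ≥0∞)⁻¹ ^ n := by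
      intro n
      rw [lintegral_mul_const'' _ (hZ n)]
      refine (mul_le_mul_left (hint n) _).trans (le_of_eq ?_)
      have hmne : (m : ℝ≥0∞) ≠ 0 := by
        simp only [ne_eq, ENNReal.coe_eq_zero]
        positivity
      rw [mul_assoc, ← mul_pow, ENNReal.coe_mul, ENNReal.mul_inv (by simp) (by simp), mul_left_comm,
        ENNReal.mul_inv_cancel hmne ENNReal.coe_ne_top, mul_one]
      rfl
    refine ne_top_of_le_ne_top ?_ (ENNReal.tsum_le_tsum hb)
    rw [ENNReal.tsum_mul_left, ENNReal.tsum_geometric, ENNReal.one_sub_inv_two, inv_inv]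
    exact ENNReal.mul_ne_top ENNReal.coe_ne_top (by simp)
  filter_upwards [ae_lt_top' (AEMeasurable.tsum fun n => (hZ n).mul_const _) hfin] with ω hω
  have hlim := ENNReal.tendsto_atTop_zero_of_tsum_ne_top hω.ne
  refine limsup_le_of_le (by isBoundedDefault) ?_
  filter_upwards [hlim.eventually (gt_mem_nhds (zero_lt_one' ℝ≥0∞)), eventually_gt_atTop 0]
    with n hn hn0
  have hZn : Z n ω ≤ ((2 * m : ℝ≥0) : ℝ≥0∞) ^ n := by
    rw [← ENNReal.inv_pow, ← div_eq_mul_inv] at hn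
    have := (ENNReal.div_le_iff (pow_ne_zero n hq0)
      (ENNReal.pow_ne_top ENNReal.coe_ne_top)).1 hn.le
    simpa using this
  have hH := (hle n ω).trans hZn
  have hHtop : H n ω ≠ ⊤ := by
    intro h
    rw [h, expMul, ENNReal.mul_top (by exact_mod_cast hθ.ne')] at hH
    simp only [EReal.coe_ennreal_top, EReal.exp_top, top_le_iff] at hH
    exact ENNReal.pow_ne_top ENNReal.coe_ne_top hH
  lift H n ω to ℝ≥0 using hHtop with x hx
  rw [expMul_coe, ← ENNReal.coe_pow, ENNReal.ofReal, ENNReal.coe_le_coe,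
    Real.toNNReal_le_iff_le_coe] at hH
  push_cast at hH
  rw [← Real.le_log_iff_exp_le (by positivity), Real.log_pow] at hH
  refine ENNReal.div_le_of_le_mul ?_
  have : x ≤ (Real.log (2 * m) / θ).toNNReal * n := by
    rw [← NNReal.coe_le_coe]
    push_cast
    rw [Real.coe_toNNReal _ (by positivity), div_mul_eq_mul_div, le_div_iff₀ hθ']
    linarith
  exact_mod_cast this

/-- If the exponential moments of `H n` grow at most geometrically, then `H n` grows at most
linearly. -/
theorem exists_ae_limsup_div_le {Ω : Type*} [MeasurableSpace Ω] (P : Measure Ω) {θ : ℝ≥0}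
    (hθ : 0 < θ) {m A : ℝ≥0∞} (hm : m ≠ ⊤) (hA : A ≠ ⊤) :
    ∃ c : ℝ≥0, 0 < c ∧ ∀ H Z : ℕ → Ω → ℝ≥0∞, (∀ n, AEMeasurable (Z n) P) →
      (∀ n ω, expMul θ (H n ω) ≤ Z n ω) → (∀ n, ∫⁻ ω, Z n ω ∂P ≤ A * m ^ n) →
      ∀ᵐ ω ∂P, limsup (fun n : ℕ => H n ω / (n : ℝ≥0∞)) atTop ≤ (c : ℝ≥0∞) := by
  lift m to ℝ≥0 using hm
  lift A to ℝ≥0 using hA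
  -- Passing to m + 1 secures the hypothesis 1 ≤ m. The constant log(2(m + 1)) / θ does not involve
  -- `H` or `Z`, so it can serve all starting points at once.
  refine ⟨_, ?_, fun H Z hZ hle hint =>
    ae_limsup_div_le (m := m + 1) (A := A) hZ hθ (by simp) hle fun n =>
      (hint n).trans (by gcongr; simp)⟩
  rw [Real.toNNReal_pos]
  refine div_pos (Real.log_pos ?_) hθ
  have : (0 : ℝ) ≤ m := m.2
  push_cast
  linarith

/-! ### Product measures -/

section Product

variable {ι α : Type*} [MeasurableSpace α] (μ : Measure α) [IsProbabilityMeasure μ]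

/-- The events which depend only on the coordinates in `S`. -/
abbrev coordSigma (ι α : Type*) [MeasurableSpace α] (S : Set ι) : MeasurableSpace (ι → α) :=
  ⨆ i ∈ S, MeasurableSpace.comap (fun c : ι → α => c i) inferInstance

lemma coordSigma_le (S : Set ι) : coordSigma ι α S ≤ MeasurableSpace.pi :=
  iSup₂_le fun i _ => (measurable_pi_apply i).comap_le

lemma coordSigma_mono {S T : Set ι} (h : S ⊆ T) : coordSigma ι α S ≤ coordSigma ι α T :=
  biSup_mono h

lemma measurable_coord {S : Set ι} {i : ι} (hi : i ∈ S) :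
    Measurable[coordSigma ι α S] fun c : ι → α => c i :=
  Measurable.of_comap_le (le_iSup₂_of_le i hi le_rfl)

/-- Functions of disjoint sets of coordinates are independent under a product measure. -/
theorem lintegral_mul_of_disjoint {S T : Set ι} (hST : Disjoint S T) {f g : (ι → α) → ℝ≥0∞}
    (hf : Measurable[coordSigma ι α S] f) (hg : Measurable[coordSigma ι α T] g) :
    ∫⁻ c, f c * g c ∂(Measure.infinitePi fun _ : ι => μ) =
      (∫⁻ c, f c ∂(Measure.infinitePi fun _ : ι => μ)) *
        ∫⁻ c, g c ∂(Measure.infinitePi fun _ : ι => μ) := by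
  refine lintegral_mul_eq_lintegral_mul_lintegral_of_independent_measurableSpace
    (coordSigma_le S) (coordSigma_le T) ?_ hf hg
  have h : iIndepFun (fun (i : ι) (c : ι → α) => c i) (Measure.infinitePi fun _ : ι => μ) :=
    iIndepFun_infinitePi (X := fun _ x => x) fun _ => measurable_id
  exact indep_iSup_of_disjoint (fun i => (measurable_pi_apply i).comap_le)
    ((iIndepFun_iff_iIndep _ _ _).1 h) hST

lemma lintegral_infinitePi_eval {f : α → ℝ≥0∞} (hf : Measurable f) (i : ι) :
    ∫⁻ c, f (c i) ∂(Measure.infinitePi fun _ : ι => μ) = ∫⁻ a, f a ∂μ :=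
  (measurePreserving_eval_infinitePi (fun _ : ι => μ) i).lintegral_comp hf

lemma lintegral_infinitePi_prod (s : Finset ι) {f : α → ℝ≥0∞} (hf : Measurable f) :
    ∫⁻ c, ∏ i ∈ s, f (c i) ∂(Measure.infinitePi fun _ : ι => μ) = (∫⁻ a, f a ∂μ) ^ s.card := by
  have h : iIndepFun (fun (i : ι) (c : ι → α) => f (c i)) (Measure.infinitePi fun _ : ι => μ) :=
    iIndepFun_infinitePi (X := fun _ x => f x) fun _ => hf
  have := lintegral_prod_eq_prod_lintegral_of_indepFun s _ h fun i =>
    hf.comp (measurable_pi_apply i)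
  simpa only [lintegral_infinitePi_eval μ hf, Finset.prod_const] using this

/-- Composition with an injection maps a product measure to a product measure. -/
lemma measurePreserving_comp_injective {κ : Type*} {e : κ → ι} (he : e.Injective) :
    MeasurePreserving (fun (c : ι → α) (k : κ) => c (e k))
      (Measure.infinitePi fun _ : ι => μ) (Measure.infinitePi fun _ : κ => μ) :=
  ⟨by fun_prop, Measure.map_infinitePi_infinitePi_of_inj he⟩

end Product

/-! ### The branching process -/

section Branching

/-- The exponential weight `exp (θ h(u))` of an individual `u`, zero if `u` is not born. -/
noncomputable def nodeWeight (θ : ℝ≥0) (c : List ℕ → ℕ × ℝ≥0) : List ℕ → ℝ≥0∞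
  | [] => 1
  | j :: u => nodeWeight θ c u * if j < (c u).1 then expMul θ (c u).2 else 0

lemma length_of_mem_generation {v : List ℕ → ℕ} {n : ℕ} {u : List ℕ} (h : u ∈ generation v n) :
    u.length = n := by
  induction n generalizing u with
  | zero => rw [show u = [] from h, List.length_nil]
  | succ n ih =>
    obtain ⟨w, hw, j, -, rfl⟩ := h
    rw [List.length_cons, ih hw]

lemma nodeWeight_of_mem_generation (θ : ℝ≥0) (c : List ℕ → ℕ × ℝ≥0) {n : ℕ} {u : List ℕ}
    (h : u ∈ generation (fun u => (c u).1) n) :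
    nodeWeight θ c u = expMul θ (nodeHeight (fun u => (c u).2) u) := by
  induction n generalizing u with
  | zero =>
    rw [show u = [] from h]
    simp [nodeWeight, nodeHeight, expMul_zero]
  | succ n ih =>
    obtain ⟨w, hw, j, hj, rfl⟩ := h
    rw [nodeWeight, nodeHeight, ih hw, if_pos hj, ENNReal.coe_add, expMul_add]

lemma measurable_childWeight (θ : ℝ≥0) (j : ℕ) :
    Measurable fun a : ℕ × ℝ≥0 => if j < a.1 then expMul θ a.2 else 0 :=
  Measurable.ite (measurableSet_lt measurable_const measurable_fst) (by fun_prop) measurable_const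

/-- The weight of `u` reads only proper suffixes of `u`, all strictly shorter; hence the data at `u`
itself are independent of it. -/
lemma measurable_nodeWeight (θ : ℝ≥0) (u : List ℕ) :
    Measurable[coordSigma (List ℕ) (ℕ × ℝ≥0) {w | w.length < u.length}]
      fun c => nodeWeight θ c u := by
  induction u with
  | nil => exact measurable_const
  | cons j u ih =>
    have hsub : {w : List ℕ | w.length < u.length} ⊆ {w | w.length < (j :: u).length} :=
      fun w (hw : w.length < u.length) => hw.trans (by simp)
    exact Measurable.mul (ih.mono (coordSigma_mono hsub) le_rfl)
      ((measurable_childWeight θ j).comp (measurable_coord (by simp)))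

/-- The total exponential weight of a generation. -/
noncomputable def generationWeight (θ : ℝ≥0) (n : ℕ) (c : List ℕ → ℕ × ℝ≥0) : ℝ≥0∞ :=
  ∑' u : {u : List ℕ // u.length = n}, nodeWeight θ c u

variable (μ : Measure (ℕ × ℝ≥0)) [IsProbabilityMeasure μ]

lemma measurable_nodeWeight_pi (θ : ℝ≥0) (u : List ℕ) :
    Measurable fun c : List ℕ → ℕ × ℝ≥0 => nodeWeight θ c u :=
  (measurable_nodeWeight θ u).mono (coordSigma_le _) le_rfl

lemma lintegral_nodeWeight_cons (θ : ℝ≥0) (j : ℕ) (u : List ℕ) :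
    ∫⁻ c, nodeWeight θ c (j :: u) ∂(Measure.infinitePi fun _ : List ℕ => μ) =
      (∫⁻ c, nodeWeight θ c u ∂(Measure.infinitePi fun _ : List ℕ => μ)) *
        ∫⁻ a, (if j < a.1 then expMul θ a.2 else 0) ∂μ := by
  rw [← lintegral_infinitePi_eval μ (measurable_childWeight θ j) u]
  refine lintegral_mul_of_disjoint μ (T := {u}) ?_ (measurable_nodeWeight θ u)
    ((measurable_childWeight θ j).comp (measurable_coord (Set.mem_singleton u)))
  simp

lemma sum_childWeight (θ : ℝ≥0) (a : ℕ × ℝ≥0) :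
    ∑' j : ℕ, (if j < a.1 then expMul θ a.2 else 0) = a.1 * expMul θ a.2 := by
  rw [tsum_eq_sum (s := Finset.range a.1) fun j hj => if_neg (by simpa using hj),
    Finset.sum_congr rfl fun j hj => if_pos (Finset.mem_range.1 hj)]
  simp

/-- A word of length n + 1 is a child index and a parent. Summing the factor of the last step over
the child index gives v · exp(θ s), whose mean factors out by independence. Unborn words have weight
zero, so all words may be summed. -/
lemma lintegral_generationWeight_le (θ : ℝ≥0) (n : ℕ) :
    ∫⁻ c, generationWeight θ n c ∂(Measure.infinitePi fun _ : List ℕ => μ) ≤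
      (∫⁻ a, a.1 * expMul θ a.2 ∂μ) ^ n := by
  unfold generationWeight
  rw [lintegral_tsum fun u : {u : List ℕ // u.length = n} =>
    (measurable_nodeWeight_pi θ u).aemeasurable]
  induction n with
  | zero =>
    have : Unique {u : List ℕ // u.length = 0} :=
      ⟨⟨⟨[], rfl⟩⟩, fun u => Subtype.ext (List.length_eq_zero_iff.1 u.2)⟩
    rw [tsum_fintype, Fintype.sum_unique]
    have : (default : {u : List ℕ // u.length = 0}).1 = [] :=
      List.length_eq_zero_iff.1 (default : {u : List ℕ // u.length = 0}).2
    simp [this, nodeWeight]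
  | succ n ih =>
    let e : {u : List ℕ // u.length = n + 1} → {u : List ℕ // u.length = n} × ℕ :=
      fun w => (⟨w.1.tail, by simp [w.2]⟩, w.1.headD 0)
    have hsplit : ∀ w : {u : List ℕ // u.length = n + 1}, w.1 = (e w).2 :: (e w).1.1 := by
      rintro ⟨_ | ⟨i, u⟩, hu⟩
      · simp at hu
      · rfl
    have he : e.Injective := fun a b h => Subtype.ext (by rw [hsplit a, hsplit b, h])
    have hsum : ∑' j : ℕ, ∫⁻ a : ℕ × ℝ≥0, (if j < a.1 then expMul θ a.2 else 0) ∂μ =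
        ∫⁻ a, a.1 * expMul θ a.2 ∂μ := by
      rw [← lintegral_tsum fun j => (measurable_childWeight θ j).aemeasurable]
      simp_rw [sum_childWeight]
    calc ∑' w : {u : List ℕ // u.length = n + 1},
          ∫⁻ c, nodeWeight θ c w ∂(Measure.infinitePi fun _ : List ℕ => μ)
        = ∑' w, (fun p : {u : List ℕ // u.length = n} × ℕ =>
          ∫⁻ c, nodeWeight θ c (p.2 :: p.1.1) ∂(Measure.infinitePi fun _ : List ℕ => μ)) (e w) :=
          tsum_congr fun w => by rw [hsplit w]
      _ ≤ ∑' p : {u : List ℕ // u.length = n} × ℕ,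
          ∫⁻ c, nodeWeight θ c (p.2 :: p.1.1) ∂(Measure.infinitePi fun _ : List ℕ => μ) :=
          ENNReal.tsum_comp_le_tsum_of_injective he _
      _ = (∑' u : {u : List ℕ // u.length = n},
          ∫⁻ c, nodeWeight θ c u ∂(Measure.infinitePi fun _ : List ℕ => μ)) *
            ∫⁻ a, a.1 * expMul θ a.2 ∂μ := by
          rw [ENNReal.tsum_prod']
          simp_rw [lintegral_nodeWeight_cons, ENNReal.tsum_mul_left,
            hsum, ENNReal.tsum_mul_right]
      _ ≤ _ := by
          rw [pow_succ]
          gcongr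

lemma LightTailed.lintegral_natCast_ne_top {ρ : Measure ℕ} (h : LightTailed ρ fun k => (k : ℝ)) :
    ∫⁻ k, (k : ℝ≥0∞) ∂ρ ≠ ⊤ := by
  obtain ⟨c, hc, h⟩ := h
  have hk : ∀ k : ℕ, (k : ℝ≥0∞) ≤ ENNReal.ofReal c⁻¹ * ENNReal.ofReal (Real.exp (c * k)) := by
    intro k
    rw [← ENNReal.ofReal_mul (by positivity), ← ENNReal.ofReal_natCast]
    refine ENNReal.ofReal_le_ofReal ?_
    rw [inv_mul_eq_div, le_div_iff₀ hc, mul_comm]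
    linarith [Real.add_one_le_exp (c * k)]
  refine ne_top_of_le_ne_top ?_ (lintegral_mono hk)
  rw [lintegral_const_mul _ (by fun_prop)]
  exact ENNReal.mul_ne_top ENNReal.ofReal_ne_top h.ne

theorem exists_ae_limsup_maxHeight_le (ρ : Measure ℕ) [IsProbabilityMeasure ρ]
    (hρ : LightTailed ρ fun k => (k : ℝ)) (τ : Measure ℝ≥0) [IsProbabilityMeasure τ]
    (hτ : LightTailed τ fun t => (t : ℝ)) :
    ∃ C : ℝ≥0, 0 < C ∧ ∀ᵐ c ∂(Measure.infinitePi fun _ : List ℕ => ρ.prod τ),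
      limsup (fun n : ℕ =>
        maxHeight (fun u => (c u).1) (fun u => (c u).2) n / (n : ℝ≥0∞)) atTop ≤ (C : ℝ≥0∞) := by
  obtain ⟨θ, hθ, hfin⟩ := hτ.exists_expMul (Y := id)
  -- Independence of progeny and height splits the mean, so every θ admissible for the height works.
  have hm : ∫⁻ a, a.1 * expMul θ a.2 ∂(ρ.prod τ) ≠ ⊤ := by
    rw [lintegral_prod_mul (f := fun k : ℕ => (k : ℝ≥0∞)) (g := fun t : ℝ≥0 => expMul θ t)
      (by fun_prop) (by fun_prop)]
    exact ENNReal.mul_ne_top hρ.lintegral_natCast_ne_top hfin.ne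
  obtain ⟨C, hC, h⟩ := exists_ae_limsup_div_le (Measure.infinitePi fun _ : List ℕ => ρ.prod τ) hθ
    (m := ∫⁻ a, a.1 * expMul θ a.2 ∂(ρ.prod τ) + 1) (A := 2) (by simpa using hm) (by simp)
  -- The added 1 covers extinction: an empty generation has maximal height 0 and exponential 1. It
  -- is absorbed by m ^ n + 1 ≤ 2 (m + 1) ^ n.
  refine ⟨C, hC, h _ (fun n c => generationWeight θ n c + 1) (fun n => ?_) (fun n c => ?_)
    fun n => ?_⟩
  · exact ((Measurable.tsum fun u => measurable_nodeWeight_pi θ _).add_const 1).aemeasurable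
  · refine expMul_iSup_le hθ le_add_self fun u => expMul_iSup_le hθ le_add_self fun hu => ?_
    rw [← nodeWeight_of_mem_generation θ c hu]
    exact (ENNReal.le_tsum (f := fun u : {u : List ℕ // u.length = n} => nodeWeight θ c u)
      ⟨u, length_of_mem_generation hu⟩).trans le_self_add
  · rw [lintegral_add_right _ measurable_const, lintegral_const, measure_univ, mul_one, two_mul]
    refine add_le_add ((lintegral_generationWeight_le _ θ n).trans ?_) (one_le_pow₀ le_add_self)
    gcongr
    exact le_self_add

end Branching

/-! ### Finite connected sets of lattice points are ranges of short walks -/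

section Walks

variable {d : ℕ}

/-- The set of the points visited by the walk with steps `l` that starts from `x`. -/
def visited (x : Fin d → ℤ) : List (Fin d → ℤ) → Finset (Fin d → ℤ)
  | [] => {x}
  | s :: l => insert x (visited (x + s) l)

lemma self_mem_visited (x : Fin d → ℤ) (l : List (Fin d → ℤ)) : x ∈ visited x l := by
  cases l <;> simp [visited]

lemma card_visited_le (x : Fin d → ℤ) (l : List (Fin d → ℤ)) :
    (visited x l).card ≤ l.length + 1 := by
  induction l generalizing x with
  | nil => simp [visited]
  | cons s l ih => exact (Finset.card_insert_le _ _).trans (Nat.succ_le_succ (ih _))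

/-- The steps between neighbours for the sup norm. -/
noncomputable abbrev unitSteps (d : ℕ) : Finset (Fin d → ℤ) := Finset.Icc (-1) 1

lemma neg_mem_unitSteps {s : Fin d → ℤ} (hs : s ∈ unitSteps d) : -s ∈ unitSteps d := by
  rw [Finset.mem_Icc] at hs ⊢
  exact ⟨neg_le_neg hs.2, neg_le.1 hs.1⟩

lemma visited_cons_neg_cons (x s : Fin d → ℤ) (l : List (Fin d → ℤ)) :
    visited x (s :: -s :: l) = insert (x + s) (visited x l) := by
  rw [visited, visited, add_neg_cancel_right, Finset.insert_comm,
    Finset.insert_eq_of_mem (self_mem_visited x l)]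

/-- A walk can make a detour to a neighbour of a point which it visits. -/
lemma exists_visited_eq_insert {x u s : Fin d → ℤ} {l : List (Fin d → ℤ)}
    (hl : ∀ t ∈ l, t ∈ unitSteps d) (hu : u ∈ visited x l) (hs : s ∈ unitSteps d) :
    ∃ l' : List (Fin d → ℤ), l'.length = l.length + 2 ∧ (∀ t ∈ l', t ∈ unitSteps d) ∧
      visited x l' = insert (u + s) (visited x l) := by
  -- The steps `s`, `-s` are inserted at the first visit to `u`; the walk is back at `u` afterwards,
  -- so the rest of it is unchanged.
  by_cases hux : u = x
  · subst hux
    refine ⟨s :: -s :: l, by simp, ?_, visited_cons_neg_cons u s l⟩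
    simp only [List.mem_cons, forall_eq_or_imp]
    exact ⟨hs, neg_mem_unitSteps hs, hl⟩
  · match l with
    | [] => exact absurd (Finset.mem_singleton.1 hu) hux
    | t :: l =>
      have hl' := List.forall_mem_cons.1 hl
      obtain ⟨l', hlen, hmem, hvis⟩ :=
        exists_visited_eq_insert hl'.2 ((Finset.mem_insert.1 hu).resolve_left hux) hs
      refine ⟨t :: l', by simp [hlen], List.forall_mem_cons.2 ⟨hl'.1, hmem⟩, ?_⟩
      rw [visited, hvis, Finset.insert_comm, visited]
termination_by l.length

lemma exists_rel_of_reflTransGen {α : Type*} {r : α → α → Prop} {A : Set α} {a b : α}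
    (h : Relation.ReflTransGen r a b) (ha : a ∈ A) (hb : b ∉ A) :
    ∃ u ∈ A, ∃ v ∉ A, r u v := by
  induction h with
  | refl => exact absurd ha hb
  | @tail b c _ hbc ih =>
    by_cases h : b ∈ A
    · exact ⟨b, h, c, hb, hbc⟩
    · exact ih h

/-- A finite connected set is the range of a walk whose length is less than twice its
cardinality. -/
lemma exists_visited_eq {x : Fin d → ℤ} {C : Finset (Fin d → ℤ)} (hx : x ∈ C)
    (hC : ∀ y ∈ C, Relation.ReflTransGen (fun u v => v ∈ C ∧ v - u ∈ unitSteps d) x y) :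
    ∃ l : List (Fin d → ℤ), l.length ≤ 2 * C.card ∧ (∀ t ∈ l, t ∈ unitSteps d) ∧
      visited x l = C := by
  -- The walk grows one new point at a time, each costing a detour of two steps; a connecting chain
  -- to a point not yet visited supplies the edge to cross.
  have key : ∀ n, n + 1 ≤ C.card → ∃ l : List (Fin d → ℤ), l.length = 2 * n ∧
      (∀ t ∈ l, t ∈ unitSteps d) ∧ visited x l ⊆ C ∧ (visited x l).card = n + 1 := by
    intro n
    induction n with
    | zero => exact fun _ => ⟨[], rfl, by simp, by simpa [visited] using hx, by simp [visited]⟩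
    | succ n ih =>
      intro hn
      obtain ⟨l, hlen, hl, hsub, hcard⟩ := ih (by omega)
      obtain ⟨y, hy, hyl⟩ : ∃ y ∈ C, y ∉ visited x l :=
        Finset.exists_mem_notMem_of_card_lt_card (by omega)
      obtain ⟨u, hu, v, hv, hvC, huv⟩ := exists_rel_of_reflTransGen
        (A := (visited x l : Set (Fin d → ℤ))) (hC y hy) (self_mem_visited x l) hyl
      obtain ⟨l', hlen', hl', hvis⟩ := exists_visited_eq_insert hl hu huv
      rw [add_sub_cancel] at hvis
      refine ⟨l', by omega, hl', ?_, ?_⟩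
      · rw [hvis]
        exact Finset.insert_subset hvC hsub
      · rw [hvis, Finset.card_insert_of_notMem hv, hcard]
  have hpos : 0 < C.card := Finset.card_pos.2 ⟨x, hx⟩
  obtain ⟨l, hlen, hl, hsub, hcard⟩ := key (C.card - 1) (by omega)
  exact ⟨l, by omega, hl, Finset.eq_of_subset_of_card_le hsub (by omega)⟩

end Walks

/-! ### Clumps are connected -/

section Clump

variable {d : ℕ} {η : (Fin d → ℤ) → Site}

lemma reflTransGen_of_mem_ball {a x y : Fin d → ℤ} (hx : x ∈ ball η a) (hy : y ∈ ball η a) :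
    Relation.ReflTransGen (fun u v => v ∈ ball η a ∧ v - u ∈ unitSteps d) x y := by
  -- The displacement `y - x` is clamped coordinatewise to [-k, k]. Each coordinate stays between
  -- those of `x` and `y`, hence in the box, and moves by at most 1 per step.
  let p : ℕ → Fin d → ℤ := fun k i => x i + max (-(k : ℤ)) (min k (y i - x i))
  have hstep : ∀ k, p k.succ ∈ ball η a ∧ p k.succ - p k ∈ unitSteps d := by
    intro k
    refine ⟨⟨hx.1, fun i => ?_⟩, Finset.mem_Icc.2 ⟨fun i => ?_, fun i => ?_⟩⟩
    · have h1 := abs_le.1 (hx.2 i)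
      have h2 := abs_le.1 (hy.2 i)
      rw [abs_le]
      simp only [p]
      omega
    · simp only [p, Pi.sub_apply, Pi.neg_apply, Pi.one_apply]
      push_cast
      omega
    · simp only [p, Pi.sub_apply, Pi.one_apply]
      push_cast
      omega
  have hp : ∀ k, Relation.ReflTransGen (fun u v => v ∈ ball η a ∧ v - u ∈ unitSteps d) x (p k) := by
    intro k
    induction k with
    | zero =>
      have : p 0 = x := by
        funext i
        simp only [p]
        push_cast
        omega
      rw [this]
    | succ k ih => exact ih.tail (hstep k)
  have hend : p (∑ i, (y i - x i).natAbs) = y := by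
    funext i
    have : (y i - x i).natAbs ≤ ∑ i, (y i - x i).natAbs :=
      Finset.single_le_sum (f := fun i => (y i - x i).natAbs) (fun _ _ => Nat.zero_le _)
        (Finset.mem_univ i)
    simp only [p]
    omega
  exact hend ▸ hp _

/-- Consecutive balls of a chain share a point, so walks inside the balls can be concatenated
without leaving the clump. -/
lemma reflTransGen_of_mem_clump {z y : Fin d → ℤ} (hy : y ∈ clump η z) :
    Relation.ReflTransGen (fun u v => v ∈ clump η z ∧ v - u ∈ unitSteps d) z y := by
  obtain ⟨a, b, hza, hyb, hab⟩ := hy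
  induction hab generalizing y with
  | refl =>
    exact (reflTransGen_of_mem_ball hza hyb).lift id fun u v h => ⟨⟨a, a, hza, h.1, .refl⟩, h.2⟩
  | @tail b c hab hbc ih =>
    obtain ⟨w, hwb, hwc⟩ := hbc
    exact (ih hwb).trans ((reflTransGen_of_mem_ball hwc hyb).lift id fun u v h =>
      ⟨⟨a, c, hza, h.1, hab.tail ⟨w, hwb, hwc⟩⟩, h.2⟩)

lemma mem_clump_self {z y : Fin d → ℤ} (hy : y ∈ clump η z) : z ∈ clump η z := by
  obtain ⟨a, -, hza, -, -⟩ := hy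
  exact ⟨a, a, hza, hza, .refl⟩

lemma exists_visited_eq_clump {z : Fin d → ℤ} (hfin : (clump η z).Finite)
    (hne : (clump η z).Nonempty) :
    ∃ l : List (Fin d → ℤ), l.length ≤ 2 * (clump η z).ncard ∧ (∀ t ∈ l, t ∈ unitSteps d) ∧
      visited z l = hfin.toFinset := by
  rw [Set.ncard_eq_toFinset_card _ hfin]
  refine exists_visited_eq (hfin.mem_toFinset.2 (mem_clump_self hne.some_mem)) fun y hy => ?_
  simpa only [hfin.mem_toFinset] using reflTransGen_of_mem_clump (hfin.mem_toFinset.1 hy)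

lemma clumpHeight_eq_sum {z : Fin d → ℤ} (hfin : (clump η z).Finite) :
    clumpHeight η z = ∑ x ∈ hfin.toFinset, (sumHeight (η x) : ℝ≥0∞) := by
  unfold clumpHeight
  rw [tsum_subtype (clump η z) fun x => (sumHeight (η x) : ℝ≥0∞),
    tsum_eq_sum (s := hfin.toFinset) fun x hx =>
      Set.indicator_of_notMem (fun h => hx (hfin.mem_toFinset.2 h)) _]
  exact Finset.sum_congr rfl fun x hx => Set.indicator_of_mem (hfin.mem_toFinset.1 hx) _

/-! ### Translations -/

/-- The layer seen from the site `x`. -/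
def shiftLayer (x : Fin d → ℤ) (η : (Fin d → ℤ) → Site) : (Fin d → ℤ) → Site := fun z => η (z + x)

lemma mem_ball_shiftLayer {x y z : Fin d → ℤ} :
    y ∈ ball (shiftLayer x η) z ↔ y + x ∈ ball η (z + x) := by
  simp [ball, shiftLayer]

lemma ball_inter_ball_shiftLayer_nonempty {x u v : Fin d → ℤ} :
    (ball (shiftLayer x η) u ∩ ball (shiftLayer x η) v).Nonempty ↔
      (ball η (u + x) ∩ ball η (v + x)).Nonempty := by
  constructor
  · rintro ⟨y, hu, hv⟩
    exact ⟨y + x, mem_ball_shiftLayer.1 hu, mem_ball_shiftLayer.1 hv⟩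
  · rintro ⟨y, hu, hv⟩
    refine ⟨y - x, mem_ball_shiftLayer.2 ?_, mem_ball_shiftLayer.2 ?_⟩ <;>
      simpa only [sub_add_cancel]

lemma mem_clump_shiftLayer {x y z : Fin d → ℤ} :
    y ∈ clump (shiftLayer x η) z ↔ y + x ∈ clump η (z + x) := by
  constructor
  · rintro ⟨a, b, ha, hb, hab⟩
    exact ⟨a + x, b + x, mem_ball_shiftLayer.1 ha, mem_ball_shiftLayer.1 hb,
      hab.lift (· + x) fun u v h => ball_inter_ball_shiftLayer_nonempty.1 h⟩
  · rintro ⟨a, b, ha, hb, hab⟩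
    refine ⟨a - x, b - x, mem_ball_shiftLayer.2 (by simpa only [sub_add_cancel]),
      mem_ball_shiftLayer.2 (by simpa only [sub_add_cancel]),
      hab.lift (· - x) fun u v h => ball_inter_ball_shiftLayer_nonempty.2 ?_⟩
    simpa only [sub_add_cancel]

lemma clumpHeight_shiftLayer (x z : Fin d → ℤ) :
    clumpHeight (shiftLayer x η) z = clumpHeight η (z + x) := by
  unfold clumpHeight
  rw [tsum_subtype (clump (shiftLayer x η) z) fun y => (sumHeight (shiftLayer x η y) : ℝ≥0∞),
    tsum_subtype (clump η (z + x)) fun y => (sumHeight (η y) : ℝ≥0∞),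
    ← (Equiv.addRight x).tsum_eq ((clump η (z + x)).indicator _)]
  refine tsum_congr fun y => ?_
  rw [Equiv.coe_addRight]
  by_cases h : y ∈ clump (shiftLayer x η) z
  · rw [Set.indicator_of_mem h, Set.indicator_of_mem (mem_clump_shiftLayer.1 h)]
    rfl
  · rw [Set.indicator_of_notMem h, Set.indicator_of_notMem (mt mem_clump_shiftLayer.2 h)]

end Clump

/-! ### Measurability -/

section Measurability

variable {d : ℕ}

/-- Reachability is a countable union, over the number of steps, of events built recursively by
countable unions over the last intermediate point. -/
lemma measurableSet_reflTransGen {Ω α : Type*} [MeasurableSpace Ω] [Countable α]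
    {r : Ω → α → α → Prop} (hr : ∀ a b, MeasurableSet {ω | r ω a b}) (a b : α) :
    MeasurableSet {ω | Relation.ReflTransGen (r ω) a b} := by
  let reach : Ω → ℕ → α → Prop := fun ω n =>
    Nat.rec (fun b => a = b) (fun _ q b => ∃ c, q c ∧ r ω c b) n
  have hmeas : ∀ n b, MeasurableSet {ω | reach ω n b} := by
    intro n
    induction n with
    | zero => exact fun b => MeasurableSet.const (a = b)
    | succ n ih =>
      intro b
      have : {ω | reach ω (n + 1) b} = ⋃ c, {ω | reach ω n c} ∩ {ω | r ω c b} := by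
        ext ω
        simp [reach]
      rw [this]
      exact MeasurableSet.iUnion fun c => (ih c).inter (hr c b)
  have heq : {ω | Relation.ReflTransGen (r ω) a b} = ⋃ n, {ω | reach ω n b} := by
    ext ω
    simp only [Set.mem_ofPred_eq, Set.mem_iUnion]
    constructor
    · intro h
      induction h with
      | refl => exact ⟨0, rfl⟩
      | @tail c b _ hcb ih =>
        obtain ⟨n, hn⟩ := ih
        exact ⟨n + 1, c, hn, hcb⟩
    · rintro ⟨n, hn⟩
      induction n generalizing b with
      | zero => exact (show a = b from hn) ▸ .refl
      | succ n ih =>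
        obtain ⟨c, hc, hcb⟩ := hn
        exact (ih c hc).tail hcb
  rw [heq]
  exact MeasurableSet.iUnion fun n => hmeas n b

@[fun_prop]
lemma measurable_sumHeight : Measurable sumHeight := by
  refine measurable_from_prod_countable_right fun k => ?_
  exact Finset.measurable_sum (Finset.range k) (f := fun i (m : ℕ → ℝ≥0 × ℝ≥0) => (m i).2) fun i _ => by fun_prop

@[fun_prop]
lemma measurable_maxRadius : Measurable maxRadius := by
  refine measurable_from_prod_countable_right fun k => ?_
  have hm : ∀ i : ℕ, Measurable fun m : ℕ → ℝ≥0 × ℝ≥0 => halfSide (m i).1 := fun i =>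
    (Nat.measurable_floor.comp (by fun_prop)).add_const 1
  convert Finset.sup_induction (p := fun f : (ℕ → ℝ≥0 × ℝ≥0) → ℕ => Measurable f)
    (s := Finset.range k) (f := fun i m => halfSide (m i).1) measurable_const
    (fun f hf g hg => hf.sup hg) (fun i _ => hm i) using 2 with m
  simp [maxRadius, Finset.sup_apply]

lemma measurableSet_mem_ball (y z : Fin d → ℤ) :
    MeasurableSet {η : (Fin d → ℤ) → Site | y ∈ ball η z} := by
  have h : Measurable fun η : (Fin d → ℤ) → Site => ((η z).1, maxRadius (η z)) := by fun_prop
  exact h (MeasurableSet.of_discrete (s := {p : ℕ × ℕ | 1 ≤ p.1 ∧ ∀ i, |y i - z i| ≤ (p.2 : ℤ)}))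

lemma measurableSet_mem_clump (y z : Fin d → ℤ) :
    MeasurableSet {η : (Fin d → ℤ) → Site | y ∈ clump η z} := by
  have hr : ∀ u v : Fin d → ℤ,
      MeasurableSet {η : (Fin d → ℤ) → Site | (ball η u ∩ ball η v).Nonempty} := by
    intro u v
    have : {η : (Fin d → ℤ) → Site | (ball η u ∩ ball η v).Nonempty} =
        ⋃ w, {η | w ∈ ball η u} ∩ {η | w ∈ ball η v} := by
      ext η
      simp [Set.Nonempty]
    rw [this]
    exact MeasurableSet.iUnion fun w => (measurableSet_mem_ball w u).inter
      (measurableSet_mem_ball w v)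
  have : {η : (Fin d → ℤ) → Site | y ∈ clump η z} = ⋃ a, ⋃ b, {η | z ∈ ball η a} ∩
      ({η | y ∈ ball η b} ∩
        {η | Relation.ReflTransGen (fun u v => (ball η u ∩ ball η v).Nonempty) a b}) := by
    ext η
    simp [clump]
  rw [this]
  exact MeasurableSet.iUnion fun a => MeasurableSet.iUnion fun b =>
    (measurableSet_mem_ball z a).inter ((measurableSet_mem_ball y b).inter
      (measurableSet_reflTransGen hr a b))

@[fun_prop]
lemma measurable_clumpHeight (z : Fin d → ℤ) :
    Measurable fun η : (Fin d → ℤ) → Site => clumpHeight η z := by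
  classical
  have : (fun η : (Fin d → ℤ) → Site => clumpHeight η z) =
      fun η => ∑' x, if x ∈ clump η z then (sumHeight (η x) : ℝ≥0∞) else 0 := by
    funext η
    unfold clumpHeight
    rw [tsum_subtype (clump η z) fun x => (sumHeight (η x) : ℝ≥0∞)]
    exact tsum_congr fun x => Set.indicator_apply _ _ _
  rw [this]
  exact Measurable.tsum fun x => Measurable.ite (measurableSet_mem_clump x z) (by fun_prop)
    measurable_const

end Measurability

/-! ### Exponential moments of the height of a clump -/

section Moments

variable {d : ℕ} (lam : ℝ≥0) (ν : Measure (ℝ≥0 × ℝ≥0)) [IsProbabilityMeasure ν]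

instance : IsProbabilityMeasure (siteLaw lam ν) := by
  unfold siteLaw
  infer_instance

lemma layerLaw_eq : layerLaw d lam ν = Measure.infinitePi fun _ : Fin d → ℤ => siteLaw lam ν := rfl

lemma lintegral_pow_poissonMeasure_ne_top {a : ℝ≥0∞} (ha : a ≠ ⊤) :
    ∫⁻ k, a ^ k ∂poissonMeasure lam ≠ ⊤ := by
  lift a to ℝ≥0 using ha
  have hsum : Summable fun k : ℕ => Real.exp (-lam) * ((lam * a : ℝ) ^ k / (k.factorial : ℝ)) :=
    (Real.summable_pow_div_factorial _).mul_left _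
  unfold poissonMeasure
  rw [lintegral_sum_measure]
  simp only [lintegral_smul_measure, lintegral_dirac, smul_eq_mul]
  refine ne_of_eq_of_ne (tsum_congr fun k => ?_) hsum.tsum_ofReal_ne_top
  rw [← ENNReal.ofReal_coe_nnreal, ← ENNReal.ofReal_pow (by positivity),
    ← ENNReal.ofReal_mul (by positivity)]
  congr 1
  rw [mul_pow]
  ring

/-- Given the number k of grains the expectation is a k-th power, and the Poisson generating
function is finite everywhere; the same θ therefore works. -/
lemma lintegral_expMul_sumHeight_ne_top {θ : ℝ≥0} (h : ∫⁻ m, expMul θ m.2 ∂ν < ⊤) :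
    ∫⁻ a, expMul θ (sumHeight a) ∂siteLaw lam ν ≠ ⊤ := by
  have hk : ∀ k : ℕ, ∫⁻ m : ℕ → ℝ≥0 × ℝ≥0, expMul θ (sumHeight (k, m))
      ∂(Measure.infinitePi fun _ : ℕ => ν) = (∫⁻ m, expMul θ m.2 ∂ν) ^ k := by
    intro k
    have := lintegral_infinitePi_prod ν (Finset.range k)
      (f := fun m : ℝ≥0 × ℝ≥0 => expMul θ m.2) (by fun_prop)
    rw [Finset.card_range] at this
    rw [← this]
    refine lintegral_congr fun m => ?_
    rw [← expMul_sum, sumHeight, ENNReal.ofNNReal_finsetSum]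
  unfold siteLaw
  rw [lintegral_prod _ (by fun_prop)]
  simp_rw [hk]
  exact lintegral_pow_poissonMeasure_ne_top lam h.ne

/-- The sum over the walks of length `n` from the origin of the exponential weights of the ranges,
discounted by `b ^ n`. -/
noncomputable def walkWeight (θ : ℝ≥0) (b : ℝ≥0∞) (η : (Fin d → ℤ) → Site) : ℝ≥0∞ :=
  ∑' n : ℕ, ∑ g : Fin n → unitSteps d,
    b ^ n * ∏ x ∈ visited 0 (List.ofFn fun i => (g i : Fin d → ℤ)), expMul θ (sumHeight (η x))

lemma measurable_walkWeight (θ : ℝ≥0) (b : ℝ≥0∞) :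
    Measurable (walkWeight θ b : ((Fin d → ℤ) → Site) → ℝ≥0∞) := by
  refine Measurable.tsum fun n => Finset.measurable_sum _ fun g _ =>
    Measurable.const_mul (Finset.measurable_prod _ fun x _ => ?_) _
  fun_prop

/-- A fixed walk of length n visits at most n + 1 sites, with i.i.d. weights of mean φ ≥ 1, so its
product has mean at most φ ^ (n + 1). -/
lemma lintegral_walkWeight_le (θ : ℝ≥0) (b : ℝ≥0∞) :
    ∫⁻ η, walkWeight θ b η ∂layerLaw d lam ν ≤
      (∫⁻ a, expMul θ (sumHeight a) ∂siteLaw lam ν) *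
        ∑' n : ℕ, ((unitSteps d).card * b * ∫⁻ a, expMul θ (sumHeight a) ∂siteLaw lam ν) ^ n := by
  set φ := ∫⁻ a, expMul θ (sumHeight a) ∂siteLaw lam ν with hφ
  have hφ1 : 1 ≤ φ := by
    refine le_trans (le_of_eq ?_) (lintegral_mono fun a => one_le_expMul θ _)
    simp
  have hmeas : Measurable fun a : Site => expMul θ (sumHeight a) := by fun_prop
  have hprod : ∀ s : Finset (Fin d → ℤ), Measurable fun η : (Fin d → ℤ) → Site =>
      ∏ x ∈ s, expMul θ (sumHeight (η x)) := fun s => by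
    exact Finset.measurable_prod _ fun x _ => by fun_prop
  unfold walkWeight
  rw [lintegral_tsum fun n => (Finset.measurable_sum _ fun g _ =>
    (hprod _).const_mul _).aemeasurable, ← ENNReal.tsum_mul_left]
  refine ENNReal.tsum_le_tsum fun n => ?_
  rw [lintegral_finsetSum _ fun g _ => (hprod _).const_mul _]
  have hb : ∀ g ∈ (Finset.univ : Finset (Fin n → unitSteps d)),
      ∫⁻ η, b ^ n * ∏ x ∈ visited 0 (List.ofFn fun i => (g i : Fin d → ℤ)),
        expMul θ (sumHeight (η x)) ∂layerLaw d lam ν ≤ b ^ n * φ ^ (n + 1) := by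
    intro g _
    rw [lintegral_const_mul _ (hprod _), layerLaw_eq, lintegral_infinitePi_prod _ _ hmeas, ← hφ]
    gcongr
    simpa using card_visited_le 0 (List.ofFn fun i => (g i : Fin d → ℤ))
  refine (Finset.sum_le_card_nsmul _ _ _ hb).trans (le_of_eq ?_)
  rw [Finset.card_univ, Fintype.card_fun, Fintype.card_fin, Fintype.card_coe, nsmul_eq_mul]
  push_cast
  ring

/-- The single term of a walk that traces the clump already dominates: its length is at most twice
the cardinality and b ≤ 1. For an empty clump the walk with no steps does. -/
lemma expMul_clumpHeight_mul_le_walkWeight (θ : ℝ≥0) {b : ℝ≥0∞} (hb : b ≤ 1)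
    {η : (Fin d → ℤ) → Site} (hfin : (clump η 0).Finite) :
    expMul θ (clumpHeight η 0) * b ^ (2 * (clump η 0).ncard) ≤ walkWeight θ b η := by
  have hterm : ∀ l : List (Fin d → ℤ), (∀ t ∈ l, t ∈ unitSteps d) →
      b ^ l.length * ∏ x ∈ visited 0 l, expMul θ (sumHeight (η x)) ≤ walkWeight θ b η := by
    intro l hl
    let g : Fin l.length → unitSteps d := fun i => ⟨l.get i, hl _ (List.get_mem l i)⟩
    have hg : (List.ofFn fun i => (g i : Fin d → ℤ)) = l := List.ofFn_get l
    refine le_trans ?_ (ENNReal.le_tsum l.length)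
    refine le_trans (le_of_eq ?_) (Finset.single_le_sum (fun _ _ => zero_le) (Finset.mem_univ g))
    rw [hg]
  rw [clumpHeight_eq_sum hfin, expMul_sum]
  rcases (clump η 0).eq_empty_or_nonempty with he | hne
  · have : hfin.toFinset = ∅ := by simpa using he
    rw [this, he]
    refine le_trans ?_ (hterm [] (by simp))
    simpa [visited] using one_le_expMul θ _
  · obtain ⟨l, hlen, hl, hvis⟩ := exists_visited_eq_clump hfin hne
    refine le_trans ?_ (hterm l hl)
    rw [hvis, mul_comm]
    exact mul_le_mul_left (pow_le_pow_right_of_le_one' hb hlen) _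

/-- A pointwise form of Hölder's inequality, needed because height and cardinality are dependent.
With w = θ₀ x - a N and θ = t θ₀, the exponent θ x is t w + t a N; two uses of 2uv ≤ u² + v²
separate w from N, and exp(κ N / 2) pays for the factor N + 1. -/
lemma exists_exp_bound {κ a θ₀ : ℝ} (hκ : 0 < κ) (ha : 0 ≤ a) (hθ₀ : 0 < θ₀) :
    ∃ θ > 0, ∃ K ≥ 0, ∀ (N : ℕ) (x : ℝ),
      (N + 1) * Real.exp (θ * x) ≤
        K * (1 + Real.exp (κ * N) + Real.exp (θ₀ * x - a * N)) := by
  -- After two squarings the exponents are 4 t w and 4 t a N: the first condition gives exp(4 t w) ≤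
  -- 1 + exp w, the second exp(4 t a N) ≤ exp(κ N).
  obtain ⟨t, ht, ht1, hta⟩ : ∃ t > 0, 4 * t ≤ 1 ∧ 4 * t * a ≤ κ := by
    refine ⟨min (1 / 4) (κ / (4 * (a + 1))), by positivity, ?_, ?_⟩
    · linarith [min_le_left (1 / 4) (κ / (4 * (a + 1)))]
    · have h := min_le_right (1 / 4) (κ / (4 * (a + 1)))
      rw [le_div_iff₀ (by positivity)] at h
      have h0 : 0 ≤ min (1 / 4) (κ / (4 * (a + 1))) := by positivity
      nlinarith
  refine ⟨t * θ₀, by positivity, 2 * (2 / κ + 1), by positivity, fun N x => ?_⟩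
  have hN : (0 : ℝ) ≤ N := N.cast_nonneg
  set w := θ₀ * x - a * N with hw
  set E := Real.exp (κ * N / 2) with hE
  have hE1 : 1 ≤ E := Real.one_le_exp (by positivity)
  have hNE : (N + 1 : ℝ) ≤ (2 / κ + 1) * E := by
    have h1 : κ * N / 2 ≤ E := by linarith [Real.add_one_le_exp (κ * N / 2)]
    have h2 : (N : ℝ) ≤ 2 / κ * E := by
      rw [div_mul_eq_mul_div, le_div_iff₀ hκ]
      linarith
    linarith
  have hsq : E * E = Real.exp (κ * N) := by rw [hE, ← Real.exp_add]; ring_nf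
  set F := Real.exp (t * θ₀ * x) with hF
  have hFF : F * F ≤ 1 + Real.exp w + Real.exp (κ * N) := by
    have h1 : F * F = Real.exp (2 * t * w) * Real.exp (2 * t * a * N) := by
      rw [hF, ← Real.exp_add, ← Real.exp_add, hw]
      ring_nf
    have h2 : Real.exp (2 * t * w) * Real.exp (2 * t * w) ≤ 1 + Real.exp w := by
      rw [← Real.exp_add]
      rcases le_total 0 w with h | h
      · have : Real.exp (2 * t * w + 2 * t * w) ≤ Real.exp w := Real.exp_le_exp.2 (by nlinarith)
        linarith
      · have : Real.exp (2 * t * w + 2 * t * w) ≤ 1 := Real.exp_le_one_iff.2 (by nlinarith)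
        linarith [Real.exp_pos w]
    have h3 : Real.exp (2 * t * a * N) * Real.exp (2 * t * a * N) ≤ Real.exp (κ * N) := by
      rw [← Real.exp_add]
      exact Real.exp_le_exp.2 (by nlinarith)
    nlinarith [sq_nonneg (Real.exp (2 * t * w) - Real.exp (2 * t * a * N)),
      Real.exp_pos w, Real.exp_pos (κ * N)]
  have hEF : E * F ≤ 2 * (1 + Real.exp (κ * N) + Real.exp w) := by
    nlinarith [sq_nonneg (E - F), Real.exp_pos w, Real.exp_pos (κ * N)]
  calc (N + 1 : ℝ) * F ≤ (2 / κ + 1) * E * F := by gcongr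
    _ = (2 / κ + 1) * (E * F) := by ring
    _ ≤ (2 / κ + 1) * (2 * (1 + Real.exp (κ * N) + Real.exp w)) := by gcongr
    _ = _ := by ring

/-- If the cardinality of the clump is light-tailed, then so is its height, and the two have a
joint exponential moment. -/
theorem exists_lintegral_card_mul_expMul_clumpHeight_ne_top
    (hσ : LightTailed ν fun m => (m.2 : ℝ)) (hC : ClumpLightTailed d lam ν) :
    ∃ θ : ℝ≥0, 0 < θ ∧
      ∫⁻ η, (((clump η 0).ncard : ℝ≥0∞) + 1) * expMul θ (clumpHeight η 0) ∂layerLaw d lam ν ≠ ⊤ := by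
  obtain ⟨hfin, κ, hκ, hκC⟩ := hC
  obtain ⟨θ₀, hθ₀, hθ₀σ⟩ := hσ.exists_expMul (Y := Prod.snd)
  have hφ := lintegral_expMul_sumHeight_ne_top lam ν hθ₀σ
  have hW := lintegral_walkWeight_le (d := d) lam ν θ₀
  have hφ1 : 1 ≤ ∫⁻ a, expMul θ₀ (sumHeight a) ∂siteLaw lam ν := by
    refine le_trans (le_of_eq ?_) (lintegral_mono fun a => one_le_expMul θ₀ _)
    simp
  lift ∫⁻ a, expMul θ₀ (sumHeight a) ∂siteLaw lam ν to ℝ≥0 using hφ with φ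
  rw [ENNReal.one_le_coe_iff] at hφ1
  have hcard : 1 ≤ (unitSteps d).card := Finset.card_pos.2 ⟨0, by
    rw [Finset.mem_Icc]
    exact ⟨neg_nonpos.2 zero_le_one, zero_le_one⟩⟩
  -- This discount makes the ratio of the geometric series over walk lengths equal to 1/2.
  set b : ℝ≥0 := (2 * (unitSteps d).card * φ)⁻¹ with hb
  have hD : (1 : ℝ≥0) ≤ (unitSteps d).card * φ := by
    have : (1 : ℝ≥0) ≤ (unitSteps d).card := by exact_mod_cast hcard
    exact one_le_mul this hφ1
  have hb0 : 0 < b := by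
    rw [hb]
    refine inv_pos.2 ?_
    rw [mul_assoc]
    positivity
  have hb1 : b ≤ 1 := by
    refine inv_le_one_of_one_le₀ ?_
    rw [mul_assoc]
    exact one_le_mul one_le_two hD
  have hbD : (unitSteps d).card * b * φ = 2⁻¹ := by
    have h1 : ((unitSteps d).card : ℝ≥0) ≠ 0 := by positivity
    have h2 : φ ≠ 0 := by positivity
    rw [hb]
    field_simp
  -- The choice a = -2 log b turns exp(-a N) into the discount b ^ (2N); a ≥ 0 because b ≤ 1.
  obtain ⟨θ, hθ, K, hK, hbound⟩ := exists_exp_bound (θ₀ := θ₀) hκ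
    (a := -(2 * Real.log b)) (by
      have := Real.log_nonpos b.coe_nonneg (by exact_mod_cast hb1 : (b : ℝ) ≤ 1)
      linarith) hθ₀
  lift θ to ℝ≥0 using hθ.le
  refine ⟨θ, hθ, ne_top_of_le_ne_top (b := ∫⁻ η, ENNReal.ofReal K *
    (1 + ENNReal.ofReal (Real.exp (κ * (clump η 0).ncard)) + walkWeight θ₀ b η)
      ∂layerLaw d lam ν) ?_ ?_⟩
  · rw [lintegral_const_mul' _ _ ENNReal.ofReal_ne_top,
      lintegral_add_right _ (measurable_walkWeight θ₀ b), lintegral_add_left measurable_const]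
    refine ENNReal.mul_ne_top ENNReal.ofReal_ne_top (ENNReal.add_ne_top.2
      ⟨ENNReal.add_ne_top.2 ⟨?_, hκC.ne⟩, ne_top_of_le_ne_top ?_ (hW b)⟩)
    · rw [layerLaw_eq]
      simp
    · have : ((unitSteps d).card : ℝ≥0∞) * b * φ = 2⁻¹ := by
        rw [← ENNReal.coe_natCast, ← ENNReal.coe_mul, ← ENNReal.coe_mul, hbD]
        simp
      rw [this, ENNReal.tsum_geometric, ENNReal.one_sub_inv_two, inv_inv]
      exact ENNReal.mul_ne_top ENNReal.coe_ne_top (by simp)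
  · refine lintegral_mono_ae (hfin.mono fun η hη => ?_)
    have hle := expMul_clumpHeight_mul_le_walkWeight θ₀ (b := b) (by exact_mod_cast hb1) hη
    have hX : clumpHeight η 0 = ((∑ x ∈ hη.toFinset, sumHeight (η x) : ℝ≥0) : ℝ≥0∞) := by
      rw [clumpHeight_eq_sum hη, ENNReal.ofNNReal_finsetSum]
    set N := (clump η 0).ncard
    rw [hX] at hle ⊢
    set x : ℝ≥0 := ∑ x ∈ hη.toFinset, sumHeight (η x)
    have hle' : ENNReal.ofReal (Real.exp (θ₀ * x - -(2 * Real.log b) * N)) ≤ walkWeight θ₀ b η := by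
      refine le_trans (le_of_eq ?_) hle
      have hbr : (0 : ℝ) < b := hb0
      rw [expMul_coe, ← ENNReal.ofReal_coe_nnreal, ← ENNReal.ofReal_pow b.coe_nonneg,
        ← ENNReal.ofReal_mul (Real.exp_pos _).le, sub_eq_add_neg, Real.exp_add]
      congr 2
      rw [← Real.exp_log (pow_pos hbr (2 * N)), Real.log_pow]
      congr 1
      push_cast
      ring
    calc ((N : ℝ≥0∞) + 1) * expMul θ x
        = ENNReal.ofReal ((N + 1) * Real.exp (θ * x)) := by
          rw [expMul_coe, ENNReal.ofReal_mul (by positivity),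
            ENNReal.ofReal_add (by positivity) zero_le_one, ENNReal.ofReal_natCast,
            ENNReal.ofReal_one]
      _ ≤ ENNReal.ofReal (K * (1 + Real.exp (κ * N) +
          Real.exp (θ₀ * x - -(2 * Real.log b) * N))) :=
          ENNReal.ofReal_le_ofReal (hbound N x)
      _ = ENNReal.ofReal K * (1 + ENNReal.ofReal (Real.exp (κ * N)) +
          ENNReal.ofReal (Real.exp (θ₀ * x - -(2 * Real.log b) * N))) := by
          rw [ENNReal.ofReal_mul hK, ENNReal.ofReal_add (by positivity) (by positivity),
            ENNReal.ofReal_add zero_le_one (by positivity), ENNReal.ofReal_one]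
      _ ≤ _ := by gcongr

end Moments

/-! ### Paths of the backward construction -/

section Paths

variable {d : ℕ}

/-- The exponential weight of a step from `x` to `y` in the layer `η`. -/
noncomputable def stepWeight (θ : ℝ≥0) (η : (Fin d → ℤ) → Site) (x y : Fin d → ℤ) : ℝ≥0∞ :=
  (clump η x ∪ {x}).indicator (fun _ => expMul θ (clumpHeight η x)) y

lemma measurable_stepWeight (θ : ℝ≥0) (x y : Fin d → ℤ) :
    Measurable fun η : (Fin d → ℤ) → Site => stepWeight θ η x y := by
  classical
  unfold stepWeight
  simp only [Set.indicator_apply]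
  exact Measurable.ite ((measurableSet_mem_clump y x).union (MeasurableSet.const (y = x)))
    (by fun_prop) measurable_const

lemma stepWeight_shiftLayer (θ : ℝ≥0) (η : (Fin d → ℤ) → Site) (x y : Fin d → ℤ) :
    stepWeight θ (shiftLayer x η) 0 y = stepWeight θ η x (y + x) := by
  classical
  simp only [stepWeight, Set.indicator_apply, clumpHeight_shiftLayer, zero_add, Set.mem_union,
    mem_clump_shiftLayer, Set.mem_singleton_iff, add_eq_right]

lemma tsum_stepWeight_le (θ : ℝ≥0) {η : (Fin d → ℤ) → Site} (hfin : (clump η 0).Finite) :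
    ∑' y, stepWeight θ η 0 y ≤
      (((clump η 0).ncard : ℝ≥0∞) + 1) * expMul θ (clumpHeight η 0) := by
  have hfin' : (clump η 0 ∪ {0}).Finite := hfin.union (Set.finite_singleton 0)
  unfold stepWeight
  rw [tsum_eq_sum (s := hfin'.toFinset) fun y hy =>
    Set.indicator_of_notMem (fun h => hy (hfin'.mem_toFinset.2 h)) _,
    Finset.sum_congr rfl fun y hy => Set.indicator_of_mem (hfin'.mem_toFinset.1 hy) _,
    Finset.sum_const, ← Set.ncard_eq_toFinset_card _ hfin', nsmul_eq_mul]
  gcongr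
  have := Set.ncard_union_le (clump η 0) {0}
  rw [Set.ncard_singleton] at this
  exact_mod_cast this

variable (lam : ℝ≥0) (ν : Measure (ℝ≥0 × ℝ≥0)) [IsProbabilityMeasure ν]

/-- The law of a layer is invariant under translations, so the mean total weight of a step does not
depend on its starting site. -/
lemma tsum_lintegral_stepWeight (θ : ℝ≥0) (x : Fin d → ℤ) :
    ∑' y, ∫⁻ η, stepWeight θ η x y ∂layerLaw d lam ν =
      ∑' y, ∫⁻ η, stepWeight θ η 0 y ∂layerLaw d lam ν := by
  rw [← (Equiv.addRight x).tsum_eq]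
  refine tsum_congr fun y => ?_
  have h : MeasurePreserving (shiftLayer x) (layerLaw d lam ν) (layerLaw d lam ν) :=
    measurePreserving_comp_injective _ (add_left_injective x)
  rw [Equiv.coe_addRight, ← h.lintegral_comp (measurable_stepWeight θ 0 y)]
  simp_rw [stepWeight_shiftLayer]

/-- The total exponential weight of the paths of length `n` from `x₀` to `y`. -/
noncomputable def pathWeight (θ : ℝ≥0) (x₀ : Fin d → ℤ) (c : ℤ × (Fin d → ℤ) → Site) :
    ℕ → (Fin d → ℤ) → ℝ≥0∞
  | 0, y => ({x₀} : Set (Fin d → ℤ)).indicator 1 y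
  | n + 1, y => ∑' x, pathWeight θ x₀ c n x * stepWeight θ (layer c (-(n : ℤ))) x y

lemma measurable_stepWeight_layer (θ : ℝ≥0) (n : ℤ) (x y : Fin d → ℤ) :
    Measurable[coordSigma (ℤ × (Fin d → ℤ)) Site {k | k.1 = n}]
      fun c => stepWeight θ (layer c n) x y := by
  refine (measurable_stepWeight θ x y).comp ?_
  exact @measurable_pi_lambda _ _ _ (coordSigma _ _ _) _ _ fun z => measurable_coord rfl

/-- Paths of length n read only the layers of times 0, …, -(n - 1), so the layer of time -n, used by
the next step, is independent of their weight. -/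
lemma measurable_pathWeight (θ : ℝ≥0) (x₀ : Fin d → ℤ) (n : ℕ) (y : Fin d → ℤ) :
    Measurable[coordSigma (ℤ × (Fin d → ℤ)) Site {k | -(n : ℤ) < k.1}]
      fun c => pathWeight θ x₀ c n y := by
  induction n generalizing y with
  | zero => exact measurable_const
  | succ n ih =>
    have h1 : {k : ℤ × (Fin d → ℤ) | -(n : ℤ) < k.1} ⊆ {k | -((n + 1 : ℕ) : ℤ) < k.1} :=
      fun k (hk : -(n : ℤ) < k.1) => show -((n + 1 : ℕ) : ℤ) < k.1 by omega
    have h2 : {k : ℤ × (Fin d → ℤ) | k.1 = -(n : ℤ)} ⊆ {k | -((n + 1 : ℕ) : ℤ) < k.1} :=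
      fun k (hk : k.1 = -(n : ℤ)) => show -((n + 1 : ℕ) : ℤ) < k.1 by omega
    -- Measurability of sums is restated for an arbitrary σ-algebra, to be used with the one
    -- generated by part of the coordinates.
    have htsum : ∀ {Ω : Type} {m : MeasurableSpace Ω} {f : (Fin d → ℤ) → Ω → ℝ≥0∞},
        (∀ x, Measurable (f x)) → Measurable fun ω => ∑' x, f x ω := fun h => .tsum h
    refine htsum fun x => Measurable.mul ?_ ?_
    · exact (ih x).mono (coordSigma_mono h1) le_rfl
    · exact (measurable_stepWeight_layer θ _ x y).mono (coordSigma_mono h2) le_rfl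

lemma measurable_pathWeight_pi (θ : ℝ≥0) (x₀ : Fin d → ℤ) (n : ℕ) (y : Fin d → ℤ) :
    Measurable fun c => pathWeight θ x₀ c n y :=
  (measurable_pathWeight θ x₀ n y).mono (coordSigma_le _) le_rfl

lemma lintegral_stepWeight_layer (θ : ℝ≥0) (n : ℤ) (x y : Fin d → ℤ) :
    ∫⁻ c, stepWeight θ (layer c n) x y
        ∂(Measure.infinitePi fun _ : ℤ × (Fin d → ℤ) => siteLaw lam ν) =
      ∫⁻ η, stepWeight θ η x y ∂layerLaw d lam ν := by
  have h : MeasurePreserving (fun c : ℤ × (Fin d → ℤ) → Site => layer c n)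
      (Measure.infinitePi fun _ : ℤ × (Fin d → ℤ) => siteLaw lam ν) (layerLaw d lam ν) :=
    measurePreserving_comp_injective _ (Prod.mk_right_injective n)
  exact h.lintegral_comp (measurable_stepWeight θ x y)

/-- The next layer is independent of the past and the mean step weight is the same from every site,
so each step multiplies the total by one and the same factor. -/
lemma sum_lintegral_pathWeight (θ : ℝ≥0) (x₀ : Fin d → ℤ) (n : ℕ) :
    ∑' y, ∫⁻ c, pathWeight θ x₀ c n y
        ∂(Measure.infinitePi fun _ : ℤ × (Fin d → ℤ) => siteLaw lam ν) =
      (∑' y, ∫⁻ η, stepWeight θ η 0 y ∂layerLaw d lam ν) ^ n := by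
  induction n with
  | zero =>
    simp only [pathWeight, lintegral_const, measure_univ, mul_one, pow_zero]
    rw [tsum_eq_single x₀ fun y hy => Set.indicator_of_notMem (by simpa using hy) _]
    simp
  | succ n ih =>
    have hstep : ∀ x y, ∫⁻ c, pathWeight θ x₀ c n x * stepWeight θ (layer c (-(n : ℤ))) x y
        ∂(Measure.infinitePi fun _ : ℤ × (Fin d → ℤ) => siteLaw lam ν) =
        (∫⁻ c, pathWeight θ x₀ c n x
          ∂(Measure.infinitePi fun _ : ℤ × (Fin d → ℤ) => siteLaw lam ν)) *
          ∫⁻ η, stepWeight θ η x y ∂layerLaw d lam ν := by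
      intro x y
      rw [← lintegral_stepWeight_layer lam ν θ (-(n : ℤ)) x y]
      refine lintegral_mul_of_disjoint _ ?_ (measurable_pathWeight θ x₀ n x)
        (measurable_stepWeight_layer θ _ x y)
      exact Set.disjoint_left.2 fun k (hk : -(n : ℤ) < k.1) (hk' : k.1 = -(n : ℤ)) => by omega
    have hmeas : ∀ x y, Measurable fun c : ℤ × (Fin d → ℤ) → Site =>
        pathWeight θ x₀ c n x * stepWeight θ (layer c (-(n : ℤ))) x y := fun x y =>
      (measurable_pathWeight_pi θ x₀ n x).mul
        ((measurable_stepWeight_layer θ _ x y).mono (coordSigma_le _) le_rfl)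
    simp_rw [pathWeight, lintegral_tsum fun x => (hmeas x _).aemeasurable, hstep]
    rw [ENNReal.tsum_comm]
    simp_rw [ENNReal.tsum_mul_left, tsum_lintegral_stepWeight, ENNReal.tsum_mul_right, ih,
      pow_succ]

lemma expMul_pathHeight_le (θ : ℝ≥0) (c : ℤ × (Fin d → ℤ) → Site) {n : ℕ}
    {x : Fin (n + 1) → Fin d → ℤ} (hx : IsPath c x) :
    expMul θ (pathHeight c x) ≤ pathWeight θ (x 0) c n (x (Fin.last n)) := by
  induction n with
  | zero => simp [pathHeight, expMul_zero, pathWeight]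
  | succ n ih =>
    have hx' : IsPath c fun i : Fin (n + 1) => x i.castSucc := fun i => hx i.castSucc
    have h := ih hx'
    have hlast := hx (Fin.last n)
    rw [pathHeight, Fin.sum_univ_castSucc, expMul_add, pathWeight]
    refine le_trans ?_ (ENNReal.le_tsum (x (Fin.last n).castSucc))
    refine mul_le_mul' h ?_
    rw [stepWeight, ← Fin.succ_last]
    exact (Set.indicator_of_mem hlast fun _ =>
      expMul θ (clumpHeight (layer c (-(n : ℤ))) (x (Fin.last n).castSucc))).ge

theorem exists_ae_limsup_maxPathHeight_le (hσ : LightTailed ν fun m => (m.2 : ℝ))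
    (hC : ClumpLightTailed d lam ν) :
    ∃ C : ℝ≥0, 0 < C ∧ ∀ x₀ : Fin d → ℤ,
      ∀ᵐ c ∂(Measure.infinitePi fun _ : ℤ × (Fin d → ℤ) => siteLaw lam ν),
        limsup (fun n : ℕ => maxPathHeight c x₀ n / (n : ℝ≥0∞)) atTop ≤ (C : ℝ≥0∞) := by
  obtain ⟨θ, hθ, hm⟩ := exists_lintegral_card_mul_expMul_clumpHeight_ne_top lam ν hσ hC
  have hm' : ∑' y, ∫⁻ η, stepWeight θ η 0 y ∂layerLaw d lam ν ≠ ⊤ := by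
    rw [← lintegral_tsum fun y => (measurable_stepWeight θ 0 y).aemeasurable]
    exact ne_top_of_le_ne_top hm
      (lintegral_mono_ae (hC.1.mono fun η hη => tsum_stepWeight_le θ hη))
  obtain ⟨C, hC, h⟩ := exists_ae_limsup_div_le
    (Measure.infinitePi fun _ : ℤ × (Fin d → ℤ) => siteLaw lam ν) hθ (A := 2)
    (m := ∑' y, ∫⁻ η, stepWeight θ η 0 y ∂layerLaw d lam ν + 1) (by simpa using hm') (by simp)
  refine ⟨C, hC, fun x₀ => h _ (fun n c => ∑' y, pathWeight θ x₀ c n y + 1) (fun n => ?_)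
    (fun n c => ?_) fun n => ?_⟩
  · exact ((Measurable.tsum fun y =>
      measurable_pathWeight_pi θ x₀ n y).add_const 1).aemeasurable
  · refine expMul_iSup_le hθ le_add_self fun x => ?_
    obtain ⟨x, rfl, hx⟩ := x
    exact (expMul_pathHeight_le θ c hx).trans ((ENNReal.le_tsum _).trans le_self_add)
  · rw [lintegral_add_right _ measurable_const, lintegral_const, measure_univ, mul_one, two_mul,
      lintegral_tsum fun y => (measurable_pathWeight_pi θ x₀ n y).aemeasurable,
      sum_lintegral_pathWeight]
    refine add_le_add ?_ (one_le_pow₀ le_add_self)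
    gcongr
    exact le_self_add

end Paths

end PoissonHail

/-! ### Transfer from the canonical product spaces to arbitrary realizations -/

open PoissonHail in
theorem theorem2 (d : ℕ) (lam : ℝ≥0) (ν : Measure (ℝ≥0 × ℝ≥0)) [IsProbabilityMeasure ν]
    (hξ : LightTailed ν fun m => (m.1 : ℝ) ^ d) (hσ : LightTailed ν fun m => (m.2 : ℝ))
    (hlam : (lam : ℝ≥0∞) < criticalIntensity d ν)
    (ρ : Measure ℕ) [IsProbabilityMeasure ρ] (hρ : LightTailed ρ fun k => (k : ℝ))
    (τ : Measure ℝ≥0) [IsProbabilityMeasure τ] (hτ : LightTailed τ fun t => (t : ℝ)) :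
    ∃ c : ℝ≥0, 0 < c ∧
      (∀ (Ω : Type*) [MeasurableSpace Ω] (P : Measure Ω) [IsProbabilityMeasure P]
        (v : List ℕ → Ω → ℕ) (s : List ℕ → Ω → ℝ≥0), IsBranching P ρ τ v s →
        ∀ᵐ ω ∂P, limsup (fun n : ℕ =>
          maxHeight (fun u => v u ω) (fun u => s u ω) n / (n : ℝ≥0∞)) atTop ≤ (c : ℝ≥0∞)) ∧
      (∀ (Ω : Type*) [MeasurableSpace Ω] (P : Measure Ω) [IsProbabilityMeasure P]
        (X : ℤ × (Fin d → ℤ) → Ω → Site), IsBooleanModel P lam ν X →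
        ∀ x₀ : Fin d → ℤ, ∀ᵐ ω ∂P, limsup (fun n : ℕ =>
          maxPathHeight (fun k => X k ω) x₀ n / (n : ℝ≥0∞)) atTop ≤ (c : ℝ≥0∞)) := by
  -- Below the supremum some admissible `l` exceeds `lam`, and this gives the light-tailed clump at
  -- `lam` itself.
  obtain ⟨l, hl, hlaml⟩ := lt_sSup_iff.1 hlam
  obtain ⟨c₁, hc₁, h₁⟩ := exists_ae_limsup_maxHeight_le ρ hρ τ hτ
  obtain ⟨c₂, -, h₂⟩ := exists_ae_limsup_maxPathHeight_le lam ν hσ (hl lam hlaml)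
  refine ⟨max c₁ c₂, lt_max_of_lt_left hc₁, ?_, ?_⟩
  · intro Ω _ P _ v s h
    have hlaw := h.indep.hasLaw_infinitePi h.law
      (aemeasurable_pi_iff.2 fun u => (h.law u).aemeasurable)
    -- The joint law of any realization is the product measure, so the a.s. bound pulls back with a
    -- constant that does not depend on the realization.
    rw [← hlaw.map_eq] at h₁
    filter_upwards [ae_of_ae_map hlaw.aemeasurable h₁] with ω hω
    exact hω.trans (ENNReal.coe_le_coe.2 (le_max_left _ _))
  · intro Ω _ P _ X h x₀
    have hlaw := h.indep.hasLaw_infinitePi h.law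
      (aemeasurable_pi_iff.2 fun k => (h.law k).aemeasurable)
    have h₂ := h₂ x₀
    rw [← hlaw.map_eq] at h₂
    filter_upwards [ae_of_ae_map hlaw.aemeasurable h₂] with ω hω
    exact hω.trans (ENNReal.coe_le_coe.2 (le_max_right _ _))
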